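/- Let $\mathcal M$ be a bicomplete simplicial model category that is cofibrantly generated, with set $J$ of generating trivial cofibrations. Let $C$ be a class of maps of $\mathcal M$ that is saturated (closed under retracts, pushouts and transfinite compositions) and contains $J$ (equivalently, contains all trivial cofibrations). Let $K$ be a (small) set of cofibrant objects of $\mathcal M$. A map $f$ is a \emph{$K$-colocal equivalence} if $\mathrm{map}_{\mathcal M}(A,f)$ is a weak equivalence of simplicial sets for all $A\in K$, where $\mathrm{map}_{\mathcal M}$ is the homotopy function complex. Let $R_K\mathcal M$ be the category $\mathcal M$ with the $K$-colocal equivalences as weak equivalences and the fibrations of $\mathcal M$ as fibrations (and with cofibrations the maps having the left lifting property with respect to the maps that are both), and suppose that $R_K\mathcal M$ is a cofibrantly generated model category with set of generating cofibrations $\Lambda(K)\cup J$, where $\Lambda(K)=\{A^\bullet\otimes\partial\Delta[n]\to A^\bullet\otimes\Delta[n] : A\in K,\ n\ge 0\}$ and $A^\bullet=A\otimes\Delta[\bullet]$, that is, $\Lambda(K)=\{A\otimes\partial\Delta[n]\to A\otimes\Delta[n]\}$. (1) Call an object $X$ \emph{finite relative to $C$} if $\mathcal M(X,-)$ preserves filtered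 colimits along $C$, i.e. colimits of small filtered diagrams all of whose transition maps lie in $C$. Suppose that the objects $A\otimes\Delta[n]$ ($A\in K$, $n\ge0$) and all domains and codomains of maps in $J$ are finite relative to $C$. Then the $K$-colocal equivalences are closed under filtered colimits along $C$: if $p:X\to Y$ is a natural transformation of small filtered diagrams whose transition maps all lie in $C$, and every $p_d$ is a $K$-colocal equivalence, then so is $\operatorname{colim} p$. If moreover every object of $\mathcal M$ is small relative to $C$, then $R_K\mathcal M$ is $C$-compactly generated, i.e. it is cofibrantly generated, its weak equivalences are closed under filtered colimits along $C$, and every object is small relative to $C$. (2) Suppose only that the same objects are finite relative to $C$ in the sequential sense: for each of them there is a finite cardinal $\kappa$ such that the object is $\kappa$-small relative to $C$, i.e. $\mathcal M(X,-)$ preserves the colimits of all $\lambda$-sequences of maps in $C$, for $\lambda$ a limit ordinal. Then the $K$-colocal equivalences are closed under colimits of $\lambda$-sequences of maps in $C$, for every limit ordinal $\lambda$. (3) If $\mathcal M$ is locally presentable, then every object of $\mathcal M$ is small relative to $C$. -/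

import Mathlib

open CategoryTheory Limits MonoidalCategory Simplicial HomotopicalAlgebra Opposite

universe v u

noncomputable section

namespace RightBousfield

/-! ### Weak equivalences of simplicial sets -/

/-- A map `f : S ⟶ T` of simplicial sets is a weak equivalence if, for every Kan complex `Z`,
precomposition with `f` induces a bijection `π₀ (Z ^ T) → π₀ (Z ^ S)`. -/
def SSetWeakEquivalence {S T : SSet.{v}} (f : S ⟶ T) : Prop :=
  ∀ (Z : SSet.{v}) [SSet.KanComplex Z],
    Function.Bijective (SSet.mapπ₀ ((MonoidalClosed.pre f).app Z))

/-- Kan fibrations of simplicial sets. -/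
def SSetFibration {S T : SSet.{v}} (f : S ⟶ T) : Prop :=
  SSet.modelCategoryQuillen.J.rlp f

/-! ### Simplicial model categories -/

section Simplicial

variable {M : Type u} [Category.{v} M] [SimplicialCategory M]

/-- A tensor of the object `X` with the simplicial set `S`: an object `X ⊗ S` with a unit
`S ⟶ Map(X, X ⊗ S)` such that `Map(X ⊗ S, Y) ⟶ Map(S, Map(X, Y))` is an isomorphism
for all `Y`. -/
structure SimplicialTensor (X : M) (S : SSet.{v}) where
  obj : M
  unit : S ⟶ SimplicialCategory.sHom X obj
  isIso (Y : M) : IsIso (MonoidalClosed.curry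
    (unit ▷ SimplicialCategory.sHom obj Y ≫ SimplicialCategory.sHomComp X obj Y))

attribute [instance] SimplicialTensor.isIso

/-- The morphism `X ⊗ S ⟶ Y` corresponding to a map `g : S ⟶ Map(X, Y)`. -/
def SimplicialTensor.desc {X : M} {S : SSet.{v}} (t : SimplicialTensor X S) {Y : M}
    (g : S ⟶ SimplicialCategory.sHom X Y) : t.obj ⟶ Y :=
  (eHomEquiv SSet.{v}).symm (MonoidalClosed.curry' g ≫ inv (MonoidalClosed.curry
    (t.unit ▷ SimplicialCategory.sHom t.obj Y ≫ SimplicialCategory.sHomComp X t.obj Y)))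

/-- A cotensor of the object `X` with the simplicial set `S`: an object `X ^ S` with a counit
`S ⟶ Map(X ^ S, X)` such that `Map(Y, X ^ S) ⟶ Map(S, Map(Y, X))` is an isomorphism
for all `Y`. -/
structure SimplicialCotensor (X : M) (S : SSet.{v}) where
  obj : M
  counit : S ⟶ SimplicialCategory.sHom obj X
  isIso (Y : M) : IsIso (MonoidalClosed.curry
    ((β_ S (SimplicialCategory.sHom Y obj)).hom ≫ SimplicialCategory.sHom Y obj ◁ counit ≫
      SimplicialCategory.sHomComp Y obj X))

/-- Postcomposition `Map(X, Y) ⟶ Map(X, Y')` with `g : Y ⟶ Y'`. -/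
abbrev sHomPost (X : M) {Y Y' : M} (g : Y ⟶ Y') :
    SimplicialCategory.sHom X Y ⟶ SimplicialCategory.sHom X Y' :=
  eHomWhiskerLeft SSet.{v} X g

/-- Precomposition `Map(X', Y) ⟶ Map(X, Y)` with `f : X ⟶ X'`. -/
abbrev sHomPre {X X' : M} (f : X ⟶ X') (Y : M) :
    SimplicialCategory.sHom X' Y ⟶ SimplicialCategory.sHom X Y :=
  eHomWhiskerRight SSet.{v} f Y

/-- The map `Map(B, X) ⟶ Map(A, X) ×_{Map(A, Y)} Map(B, Y)` attached to `i : A ⟶ B` and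
`p : X ⟶ Y`. -/
def pullbackHom {A B X Y : M} (i : A ⟶ B) (p : X ⟶ Y) :
    SimplicialCategory.sHom B X ⟶ pullback (sHomPost A p) (sHomPre i Y) :=
  pullback.lift (sHomPre i X) (sHomPost B p) (eHom_whisker_exchange SSet.{v} i p).symm

variable (M) in
/-- A simplicial model category: a model category enriched over simplicial sets which is
tensored and cotensored over simplicial sets (first axiom) and such that the maps `pullbackHom i p`
satisfy the usual compatibility with cofibrations, fibrations and weak equivalences. -/
class SimplicialModelCategory [ModelCategory M] where
  tensor (X : M) (S : SSet.{v}) : SimplicialTensor X S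
  cotensor (X : M) (S : SSet.{v}) : SimplicialCotensor X S
  fibration {A B X Y : M} (i : A ⟶ B) (p : X ⟶ Y) [Cofibration i] [Fibration p] :
    SSetFibration (pullbackHom i p)
  weakEquivalence {A B X Y : M} (i : A ⟶ B) (p : X ⟶ Y) [Cofibration i] [Fibration p]
    (h : WeakEquivalence i ∨ WeakEquivalence p) : SSetWeakEquivalence (pullbackHom i p)

variable [ModelCategory M] [SimplicialModelCategory M]

/-- The tensor `X ⊗ S`. -/
def sTensor (X : M) (S : SSet.{v}) : M := (SimplicialModelCategory.tensor X S).obj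

/-- The map `X ⊗ S ⟶ X ⊗ T` induced by `f : S ⟶ T`: it is the one corresponding to
`S ⟶ T ⟶ Map(X, X ⊗ T)` under `Map(X ⊗ S, X ⊗ T) ≅ Map(S, Map(X, X ⊗ T))`. -/
def sTensorMap (X : M) {S T : SSet.{v}} (f : S ⟶ T) : sTensor X S ⟶ sTensor X T :=
  (SimplicialModelCategory.tensor X S).desc (f ≫ (SimplicialModelCategory.tensor X T).unit)

/-! ### Right Bousfield localization -/

/-- `K`-colocal equivalences, for a class `K` of cofibrant objects of a simplicial model category.
For `A` cofibrant and `X ⟶ X'` a weak equivalence to a fibrant object, the simplicial set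
`Map(A, X')` is a (right) homotopy function complex `map(A, X)`: its `n`-simplices are the
morphisms from `A` to the `n`th term of the simplicial resolution `X' ^ Δ[n]` of `X`. Hence `f` is a
`K`-colocal equivalence if, for some fibrant approximation `f'` of `f` (equivalently, for any),
`Map(A, f')` is a weak equivalence for all `A` in `K`. -/
def colocalEquivalences (K : ObjectProperty M) : MorphismProperty M := fun X Y f ↦
  ∃ (X' Y' : M) (a : X ⟶ X') (b : Y ⟶ Y') (f' : X' ⟶ Y'),
    WeakEquivalence a ∧ WeakEquivalence b ∧ IsFibrant X' ∧ IsFibrant Y' ∧ a ≫ f' = f ≫ b ∧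
      ∀ A : M, K A → SSetWeakEquivalence (sHomPost A f')

/-- The cofibrations of the right Bousfield localization `R_K M`: the maps with the left lifting
property with respect to the maps which are fibrations of `M` and `K`-colocal equivalences. -/
def colocalCofibrations (K : ObjectProperty M) : MorphismProperty M :=
  (fibrations M ⊓ colocalEquivalences K).llp

/-- The set `Λ(K)` of maps `A^• ⊗ ∂Δ[n] ⟶ A^• ⊗ Δ[n]`, for `A` in `K` and `n ≥ 0`, for the
standard cosimplicial resolution `A^n = A ⊗ Δ[n]` of a cofibrant object `A`. -/
def LambdaSet (K : ObjectProperty M) : MorphismProperty M :=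
  MorphismProperty.ofHoms (fun (p : Subtype K × ℕ) ↦ sTensorMap p.1.1 (SSet.boundary p.2).ι)

end Simplicial

/-! ### Smallness and cofibrant generation -/

section Smallness

variable {M : Type u} [Category.{v} M]

/-- A saturated class: closed under retracts, pushouts and transfinite compositions. -/
structure IsSaturatedClass (C : MorphismProperty M) : Prop where
  retracts : C.IsStableUnderRetracts
  pushouts : C.IsStableUnderCobaseChange
  transfiniteCompositions : MorphismProperty.IsStableUnderTransfiniteComposition.{v} C

/-- For a well-ordered set `L` without greatest element (a limit ordinal), `F : L ⥤ M` is an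
`L`-sequence of maps in `C`: it is colimit-preserving and `F j ⟶ F (j + 1)` is in `C`
for all `j`. -/
structure IsSequenceIn (C : MorphismProperty M) {L : Type v} [LinearOrder L] [SuccOrder L]
    [OrderBot L] [WellFoundedLT L] [NoMaxOrder L] (F : L ⥤ M) : Prop where
  continuous : F.IsWellOrderContinuous
  map_succ (j : L) : C (F.map (homOfLE (Order.le_succ j)))

/-- `X` is `κ`-small relative to `C`: `Hom(X, -)` preserves the colimits of the sequences of maps
in `C` that are indexed by `κ`-filtered ordinals, i.e. limit ordinals in which every subset
of cardinality at most `κ` is bounded. -/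
def IsCardinalSmallRelativeTo (κ : Cardinal.{v}) (C : MorphismProperty M) (X : M) : Prop :=
  ∀ (L : Type v) [LinearOrder L] [SuccOrder L] [OrderBot L] [WellFoundedLT L] [NoMaxOrder L],
    (∀ s : Set L, Cardinal.mk s ≤ κ → BddAbove s) →
    ∀ F : L ⥤ M, IsSequenceIn C F → PreservesColimit F (coyoneda.obj (op X))

/-- `X` is small relative to `C`: it is `κ`-small relative to `C` for some cardinal `κ`. -/
def IsSmallRelativeTo (C : MorphismProperty M) (X : M) : Prop :=
  ∃ κ : Cardinal.{v}, IsCardinalSmallRelativeTo κ C X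

/-- `X` is sequentially finite relative to `C`: it is `κ`-small relative to `C` for some finite
cardinal `κ`. -/
def IsSequentiallyFiniteRelativeTo (C : MorphismProperty M) (X : M) : Prop :=
  ∃ k : ℕ, IsCardinalSmallRelativeTo (k : Cardinal.{v}) C X

/-- `X` is finite relative to `C`: `Hom(X, -)` preserves filtered colimits along `C`, i.e. colimits
of small filtered diagrams all of whose transition maps are in `C`. -/
def IsFiniteRelativeTo (C : MorphismProperty M) (X : M) : Prop :=
  ∀ (D : Type v) [SmallCategory D] [IsFiltered D] (F : D ⥤ M),
    (∀ ⦃d d' : D⦄ (g : d ⟶ d'), C (F.map g)) → PreservesColimit F (coyoneda.obj (op X))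

/-- `W` is closed under filtered colimits along `C`. -/
def IsClosedUnderFilteredColimitsAlong [HasColimits M] (W C : MorphismProperty M) : Prop :=
  ∀ (D : Type v) [SmallCategory D] [IsFiltered D] (F G : D ⥤ M),
    (∀ ⦃d d' : D⦄ (g : d ⟶ d'), C (F.map g)) → (∀ ⦃d d' : D⦄ (g : d ⟶ d'), C (G.map g)) →
    ∀ p : F ⟶ G, (∀ d : D, W (p.app d)) → W (colimMap p)

/-- `W` is closed under colimits of sequences of maps in `C`, indexed by limit ordinals. -/
def IsClosedUnderSequentialColimitsAlong [HasColimits M] (W C : MorphismProperty M) : Prop :=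
  ∀ (L : Type v) [LinearOrder L] [SuccOrder L] [OrderBot L] [WellFoundedLT L] [NoMaxOrder L]
    (F G : L ⥤ M), IsSequenceIn C F → IsSequenceIn C G →
    ∀ p : F ⟶ G, (∀ j : L, W (p.app j)) → W (colimMap p)

/-- Relative `I`-cell complexes: transfinite compositions of pushouts of maps in `I`. -/
def relativeCells (I : MorphismProperty M) : MorphismProperty M :=
  MorphismProperty.transfiniteCompositions.{v} I.pushouts

/-- The classes `W`, `Cof`, `Fib` of weak equivalences, cofibrations and fibrations form a model
category structure on `M`. -/
def IsModelStructure (W Cof Fib : MorphismProperty M) : Prop :=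
  ∃ h : ModelCategory M,
    h.categoryWithWeakEquivalences.weakEquivalences = W ∧
    h.categoryWithCofibrations.cofibrations = Cof ∧
    h.categoryWithFibrations.fibrations = Fib

/-- The classes `W`, `Cof`, `Fib` form a cofibrantly generated model category structure on `M` with
sets of generating cofibrations `I` and of generating trivial cofibrations `J`. -/
structure IsCofibrantlyGenerated (W Cof Fib I J : MorphismProperty M) : Prop where
  isModelStructure : IsModelStructure W Cof Fib
  isSmall_I : MorphismProperty.IsSmall.{v} I
  isSmall_J : MorphismProperty.IsSmall.{v} J
  fib_eq : Fib = J.rlp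
  trivialFib_eq : Fib ⊓ W = I.rlp
  small_I {A B : M} (i : A ⟶ B) (hi : I i) : IsSmallRelativeTo (relativeCells I) A
  small_J {A B : M} (j : A ⟶ B) (hj : J j) : IsSmallRelativeTo (relativeCells J) A

/-- The model structure `W`, `Cof`, `Fib` is `C`-compactly generated: it is cofibrantly generated,
weak equivalences are closed under filtered colimits along `C`, and every object is small
relative to `C`. -/
structure IsCompactlyGeneratedModel [HasColimits M] (W Cof Fib C : MorphismProperty M) : Prop where
  cofibrantlyGenerated : ∃ I J : MorphismProperty M, IsCofibrantlyGenerated W Cof Fib I J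
  perfect : IsClosedUnderFilteredColimitsAlong W C
  small (X : M) : IsSmallRelativeTo C X

end Smallness

end RightBousfield

end

open RightBousfield

/-!
The localized category `R_K M` has the same fibrations as `M`, so `J.rlp.llp` consists of
`K`-colocal equivalences, and the maps in `J.rlp` which are `K`-colocal equivalences are the maps
with the right lifting property against `Λ(K) ∪ J`, whose domains and codomains are finite relative
to `C`: for `A ⊗ ∂Δ[n]` this holds because `Hom(A ⊗ S, -) = Hom(S, Map(A, -))` and `∂Δ[n]` is a
finite simplicial set.

Given `p : X ⟶ Y`, the small object argument applied to the free diagrams on the maps in `J` factors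
`p` as a relative cell complex `φ : X ⟶ Z` followed by some `q : Z ⟶ Y` which is a fibration at
every index. The components and the colimit of `φ` lie in `J.rlp.llp`, so `q` lies in
`(Λ(K) ∪ J).rlp` at every index. If `Z` is again a diagram along `C`, then a lifting problem of
`colim q` against `Λ(K) ∪ J` already lives at a single index, where it can be solved; so `colim q`
is a `K`-colocal equivalence, and so is `colim p`.

To see that the transition maps of `Z` lie in `C`, write `Z d ⟶ Z d'` as the cobase change of
`X d ⟶ X d'` followed by the corner map `X d' ⊔_{X d} Z d ⟶ Z d'` of `φ`. For a poset of indices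
(which suffices, as every filtered category receives a final functor from a directed poset), the
corner map of the free diagram on `j` is an isomorphism or a copy of `j`, so the corner maps of cell
complexes lie in `J.rlp.llp`, which is contained in `C`.

For sequences, `Z` must also be continuous. The free diagram on an object at the index `c` is
continuous as long as `c` is not a limit element, so only such `c` are used; then `q` is a fibration
only at these indices, which still form a cofinal subset.
-/

namespace RightBousfield

section Coproducts

variable {M : Type u} [Category.{v} M] {C : MorphismProperty M}

lemma IsSaturatedClass.map_mem [HasColimits M] (hC : IsSaturatedClass C) {L : Type v}
    [LinearOrder L] [SuccOrder L] [OrderBot L] [WellFoundedLT L] (F : L ⥤ M)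
    [F.IsWellOrderContinuous]
    (hF : ∀ j : L, ¬ IsMax j → C (F.map (homOfLE (Order.le_succ j)))) {j k : L} (φ : j ⟶ k) :
    C (F.map φ) := by
  have := hC.retracts
  have := hC.transfiniteCompositions
  let h : C.TransfiniteCompositionOfShape L (colimit.ι F ⊥) :=
    { F := F
      isoBot := Iso.refl _
      incl := (colimit.cocone F).ι
      isColimit := colimit.isColimit F
      fac := by simp
      map_mem := hF }
  exact h.mem_map φ

lemma isPushout_colimMap_discrete {ι : Type v} {X Y : Discrete ι ⥤ M} [HasColimit X]
    [HasColimit Y] (a : X ⟶ Y) (i : Discrete ι) (ha : ∀ k, k ≠ i → IsIso (a.app k)) :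
    IsPushout (colimit.ι X i) (a.app i) (colimMap a) (colimit.ι Y i) where
  w := ι_colimMap a i
  isColimit' := ⟨by
    classical
    refine PushoutCocone.IsColimit.mk _
      (fun s ↦ colimit.desc Y ⟨s.pt, Discrete.natTrans fun k ↦
        if h : k = i then eqToHom (by rw [h]) ≫ s.inr
        else haveI := ha k h; inv (a.app k) ≫ colimit.ι X k ≫ s.inl⟩) ?_ ?_ ?_
    · intro s
      ext k
      by_cases h : k = i
      · subst h
        simp [s.condition]
      · have := ha k h
        simp [h]
    · intro s
      simp
    · intro s m h₁ h₂
      ext k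
      by_cases h : k = i
      · subst h
        simp [h₂]
      · have := ha k h
        simp [h, ← h₁]⟩

section Step

variable {L : Type v} [LinearOrder L] (i : L)

lemma monotone_ite_lt : Monotone fun j : L ↦ if i < j then (1 : Fin 2) else 0 := by
  intro j k h
  dsimp only
  split_ifs with hj hk
  · exact le_rfl
  · exact absurd (hj.trans_le h) hk
  · exact Fin.zero_le _
  · exact le_rfl

/-- The `L`-indexed diagram which is constantly `A` on the elements `j ≤ i` and constantly `B` on
the elements `j > i`, the transition between the two being `f : A ⟶ B`. -/
def stepFunctor {A B : M} (f : A ⟶ B) : L ⥤ M :=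
  (monotone_ite_lt i).functor ⋙ ComposableArrows.mk₁ f

variable {A B : M} (f : A ⟶ B) {i}

lemma isIso_stepFunctor_map {j k : L} (φ : j ⟶ k) (h : i < j ∨ ¬ i < k) :
    IsIso ((stepFunctor i f).map φ) := by
  have isIso_map {x y : Fin 2} (ψ : x ⟶ y) (hxy : x = y) :
      IsIso ((ComposableArrows.mk₁ f).map ψ) := by
    subst hxy
    obtain rfl : ψ = 𝟙 _ := Subsingleton.elim _ _
    infer_instance
  refine isIso_map ((monotone_ite_lt i).functor.map φ) ?_
  have hjk : i < j → i < k := fun hj ↦ hj.trans_le (leOfHom φ)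
  exact if_congr ⟨hjk, fun hk ↦ h.resolve_right (not_not_intro hk)⟩ rfl rfl

lemma nonempty_arrow_stepFunctor_map_iso {j k : L} (φ : j ⟶ k) (hj : ¬ i < j) (hk : i < k) :
    Nonempty (Arrow.mk ((stepFunctor i f).map φ) ≅ Arrow.mk f) := by
  have arrow_map_iso {x y : Fin 2} (ψ : x ⟶ y) (hx : x = 0) (hy : y = 1) :
      Nonempty (Arrow.mk ((ComposableArrows.mk₁ f).map ψ) ≅ Arrow.mk f) := by
    subst hx hy
    exact ⟨Iso.refl _⟩
  exact arrow_map_iso ((monotone_ite_lt i).functor.map φ) (if_neg hj) (if_pos hk)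

lemma isWellOrderContinuous_of_isEventuallyConstantFrom {F : L ⥤ M}
    (hF : ∀ m, Order.IsSuccLimit m →
      ∃ j < m, ∀ ⦃k l⦄ (φ : k ⟶ l), j ≤ k → l ≤ m → IsIso (F.map φ)) :
    F.IsWellOrderContinuous where
  nonempty_isColimit m hm := by
    obtain ⟨j, hjm, hj⟩ := hF m hm
    have : Nonempty (Set.Iio m) := ⟨⟨j, hjm⟩⟩
    have hconst : ((Set.principalSegIio m).monotone.functor ⋙ F).IsEventuallyConstantFrom
        (⟨j, hjm⟩ : Set.Iio m) :=
      fun k φ ↦ hj ((Set.principalSegIio m).monotone.functor.map φ) le_rfl k.2.le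
    have : IsIso (((Set.principalSegIio m).cocone F).ι.app ⟨j, hjm⟩) := hj _ le_rfl le_rfl
    exact ⟨hconst.isColimitOfIsIso _⟩

instance : (stepFunctor i f).IsWellOrderContinuous :=
  isWellOrderContinuous_of_isEventuallyConstantFrom fun m hm ↦ by
    by_cases him : i < m
    · obtain ⟨j, hij, hjm⟩ := (not_covBy_iff him).1 (hm.2 i)
      exact ⟨j, hjm, fun k l φ hjk _ ↦ isIso_stepFunctor_map f φ (Or.inl (hij.trans_le hjk))⟩
    · obtain ⟨j, hjm⟩ := not_isMin_iff.1 hm.1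
      exact ⟨j, hjm, fun k l φ _ hlm ↦
        isIso_stepFunctor_map f φ (Or.inr fun hil ↦ him (hil.trans_le hlm))⟩

end Step

lemma isWellOrderContinuous_of_evaluation {K : Type*} [Category* K] {L : Type v} [PartialOrder L]
    (F : L ⥤ K ⥤ M) [∀ k, (F.flip.obj k).IsWellOrderContinuous] : F.IsWellOrderContinuous where
  nonempty_isColimit m hm :=
    ⟨evaluationJointlyReflectsColimits _ fun k ↦
      (F.flip.obj k).isColimitOfIsWellOrderContinuous m hm⟩

/-- The family of step functors which, along a well-order on `ι`, replaces the sources of the maps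
`f k` by their targets one index at a time. -/
def stepDiagram {ι : Type v} [LinearOrder ι] {X Y : Discrete ι ⥤ M} (f : X ⟶ Y) :
    WithTop ι ⥤ Discrete ι ⥤ M :=
  (Discrete.functor fun k ↦ stepFunctor (WithTop.some k) (f.app ⟨k⟩)).flip

section

variable {ι : Type v} [LinearOrder ι] {X Y : Discrete ι ⥤ M} (f : X ⟶ Y)

instance : (stepDiagram f).IsWellOrderContinuous :=
  have : ∀ k, ((stepDiagram f).flip.obj k).IsWellOrderContinuous := fun k ↦
    inferInstanceAs (stepFunctor (WithTop.some k.as) (f.app k)).IsWellOrderContinuous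
  isWellOrderContinuous_of_evaluation _

lemma nonempty_arrow_stepDiagram_map_bot_top_iso [OrderBot (WithTop ι)] :
    Nonempty (Arrow.mk ((stepDiagram f).map (homOfLE bot_le : ⊥ ⟶ ⊤)) ≅ Arrow.mk f) := by
  let e (k : Discrete ι) :=
    (nonempty_arrow_stepFunctor_map_iso (f.app k) (homOfLE bot_le : ⊥ ⟶ ⊤)
      (i := WithTop.some k.as) not_lt_bot (WithTop.coe_lt_top _)).some
  refine ⟨Arrow.isoMk (Discrete.natIso fun k ↦ Arrow.leftFunc.mapIso (e k))
    (Discrete.natIso fun k ↦ Arrow.rightFunc.mapIso (e k)) ?_⟩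
  ext k
  exact (e k).hom.w

lemma colimMap_stepDiagram_map_succ_mem [HasColimits M] [C.IsStableUnderCobaseChange]
    [SuccOrder (WithTop ι)] (hf : ∀ k, C (f.app k)) {j : WithTop ι} (hj : ¬ IsMax j) :
    C (colimMap ((stepDiagram f).map (homOfLE (Order.le_succ j)))) := by
  cases j with
  | top => exact absurd isMax_top hj
  | coe i =>
    refine C.of_isPushout (isPushout_colimMap_discrete _ (Discrete.mk i) fun k hk ↦ ?_) ?_
    · refine isIso_stepFunctor_map (i := WithTop.some k.as) (f.app k)
        (homOfLE (Order.le_succ (WithTop.some i))) ?_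
      rcases lt_or_gt_of_ne (fun h ↦ hk (Discrete.ext h) : k.as ≠ i) with h | h
      · exact Or.inl (WithTop.coe_lt_coe.2 h)
      · exact Or.inr (not_lt.2 (Order.succ_le_of_lt (WithTop.coe_lt_coe.2 h)))
    · obtain ⟨e⟩ := nonempty_arrow_stepFunctor_map_iso (i := WithTop.some i) (f.app ⟨i⟩)
        (homOfLE (Order.le_succ (WithTop.some i))) (lt_irrefl _) (Order.lt_succ_of_not_isMax hj)
      exact (C.arrow_mk_iso_iff e).2 (hf ⟨i⟩)

end

lemma IsSaturatedClass.isStableUnderCoproducts [HasColimits M] (hC : IsSaturatedClass C) :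
    MorphismProperty.IsStableUnderCoproducts.{v} C where
  isStableUnderCoproductsOfShape ι := by
    have := hC.retracts
    have := hC.pushouts
    obtain ⟨_, _⟩ := exists_wellFoundedLT ι
    let : OrderBot (WithTop ι) := WellFoundedLT.toOrderBot _
    let : SuccOrder (WithTop ι) := SuccOrder.ofLinearWellFoundedLT _
    refine MorphismProperty.IsStableUnderCoproductsOfShape.mk _ _ fun A B _ _ f hf ↦ ?_
    have : PreservesWellOrderContinuousOfShape (WithTop ι) (colim (J := Discrete ι) (C := M)) := {}
    let φ : Discrete.functor A ⟶ Discrete.functor B := Discrete.natTrans fun k ↦ f k.as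
    obtain ⟨e⟩ := nonempty_arrow_stepDiagram_map_bot_top_iso φ
    exact (C.arrow_mk_iso_iff (colim.mapArrow.mapIso e)).1
      (hC.map_mem (stepDiagram φ ⋙ colim)
        (fun _ hj ↦ colimMap_stepDiagram_map_succ_mem φ (fun k ↦ hf k.as) hj) _)

end Coproducts

section Sequences

variable {M : Type u} [Category.{v} M] {C : MorphismProperty M}

lemma IsSequenceIn.map_mem [HasColimits M] (hC : IsSaturatedClass C) {L : Type v} [LinearOrder L]
    [SuccOrder L] [OrderBot L] [WellFoundedLT L] [NoMaxOrder L] {F : L ⥤ M}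
    (hF : IsSequenceIn C F) {j k : L} (φ : j ⟶ k) : C (F.map φ) :=
  have := hF.continuous
  hC.map_mem F (fun j _ ↦ hF.map_succ j) φ

lemma IsSequentiallyFiniteRelativeTo.preservesColimit {X : M}
    (hX : IsSequentiallyFiniteRelativeTo C X) {L : Type v} [LinearOrder L]
    [SuccOrder L] [OrderBot L] [WellFoundedLT L] [NoMaxOrder L] {F : L ⥤ M}
    (hF : IsSequenceIn C F) : PreservesColimit F (coyoneda.obj (op X)) := by
  obtain ⟨k, hk⟩ := hX
  refine hk L (fun s hs ↦ ?_) F hF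
  have : s.Finite := Cardinal.lt_aleph0_iff_set_finite.1 (hs.trans_lt Cardinal.natCast_lt_aleph0)
  exact this.bddAbove

lemma IsFiniteRelativeTo.isSequentiallyFiniteRelativeTo [HasColimits M] (hC : IsSaturatedClass C)
    {X : M} (hX : IsFiniteRelativeTo C X) : IsSequentiallyFiniteRelativeTo C X :=
  ⟨0, fun L _ _ _ _ _ _ F hF ↦ hX L F fun _ _ φ ↦ hF.map_mem hC φ⟩

end Sequences

section SmallObject

variable {M : Type*} [Category.{v} M] [HasColimits M] {J C : MorphismProperty M}

attribute [local instance] Cardinal.fact_isRegular_aleph0 Cardinal.orderBotAleph0OrdToType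

lemma IsSaturatedClass.pushouts_coproducts_le (hC : IsSaturatedClass C) (hJC : J ≤ C) :
    (MorphismProperty.coproducts.{v} J).pushouts ≤ C := by
  have := hC.pushouts
  have := hC.isStableUnderCoproducts
  rwa [MorphismProperty.pushouts_le_iff, MorphismProperty.coproducts_le_iff]

lemma hasSmallObjectArgument_of_isSequentiallyFiniteRelativeTo [MorphismProperty.IsSmall.{v} J]
    (hC : IsSaturatedClass C) (hJC : J ≤ C)
    (hJ : ∀ ⦃A B : M⦄ (j : A ⟶ B), J j → IsSequentiallyFiniteRelativeTo C A) :
    MorphismProperty.HasSmallObjectArgument.{v} J := by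
  have : NoMaxOrder Cardinal.aleph0.{v}.ord.ToType := Cardinal.noMaxOrder le_rfl
  refine ⟨Cardinal.aleph0, inferInstance, inferInstance, { preservesColimit := ?_ }⟩
  intro A B X Y i hi f hf
  refine (hJ i hi).preservesColimit (F := hf.F) ⟨hf.isWellOrderContinuous, fun j ↦ ?_⟩
  exact hC.pushouts_coproducts_le (J.ofHoms_homFamily.trans_le hJC) _
    (hf.transfiniteCompositionOfShape.map_mem j (not_isMax j))

lemma IsSaturatedClass.llp_rlp_le [MorphismProperty.HasSmallObjectArgument.{v} J]
    (hC : IsSaturatedClass C) (hJC : J ≤ C) : J.rlp.llp ≤ C := by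
  have := hC.retracts
  have := hC.transfiniteCompositions
  rw [MorphismProperty.llp_rlp_of_hasSmallObjectArgument, MorphismProperty.retracts_le_iff,
    MorphismProperty.transfiniteCompositions_le_iff]
  exact hC.pushouts_coproducts_le hJC

end SmallObject

section FunctorCategory

variable {M : Type u} [Category.{v} M] {C : MorphismProperty M}
  {D : Type v} [SmallCategory D]

lemma IsSaturatedClass.functorCategory [HasColimits M] (hC : IsSaturatedClass C) :
    IsSaturatedClass (C.functorCategory D) := by
  have := hC.retracts
  have := hC.pushouts
  have := hC.transfiniteCompositions
  exact ⟨inferInstance, inferInstance, ⟨fun _ ↦ inferInstance⟩⟩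

lemma isSequentiallyFiniteRelativeTo_evaluationLeftAdjoint_obj [HasColimits M] {A : M}
    (hA : IsSequentiallyFiniteRelativeTo C A) (c : D) :
    IsSequentiallyFiniteRelativeTo (C.functorCategory D) ((evaluationLeftAdjoint M c).obj A) := by
  refine ⟨0, fun L _ _ _ _ _ _ F hF ↦ ?_⟩
  have := hF.continuous
  have := hA.preservesColimit (F := F ⋙ (evaluation D M).obj c)
    ⟨inferInstance, fun j ↦ hF.map_succ j c⟩
  let e : (evaluation D M).obj c ⋙ coyoneda.obj (op A) ≅
      coyoneda.obj (op ((evaluationLeftAdjoint M c).obj A)) :=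
    ((evaluationAdjunctionRight M c).compCoyonedaIso.app (op A)).symm
  exact preservesColimit_of_natIso F e

end FunctorCategory

section FreeMaps

variable {M : Type u} [Category.{v} M] [HasColimits M] {D : Type v} [SmallCategory D]

/-- The natural transformations obtained from the maps in `J` by applying the left adjoints of the
evaluation functors at the objects in `N`; for `N = Set.univ` they generate the trivial cofibrations
of the projective model structure when `J` generates those of `M`. -/
noncomputable def freeMaps (J : MorphismProperty M) (N : Set D) : MorphismProperty (D ⥤ M) :=
  MorphismProperty.ofHoms
    fun x : N × J.toSet ↦ (evaluationLeftAdjoint M x.1.1).map x.2.1.hom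

variable {J C : MorphismProperty M} {N : Set D}

lemma freeMaps_map {c : D} (hc : c ∈ N) {A B : M} {j : A ⟶ B} (hj : J j) :
    freeMaps J N ((evaluationLeftAdjoint M c).map j) :=
  ⟨(⟨⟨c, hc⟩, ⟨Arrow.mk j, hj⟩⟩ : N × J.toSet)⟩

lemma freeMaps_rlp_iff {X Y : D ⥤ M} (q : X ⟶ Y) :
    (freeMaps J N).rlp q ↔ ∀ c ∈ N, J.rlp (q.app c) := by
  constructor
  · intro h c hc A B j hj
    exact ((evaluationAdjunctionRight M c).hasLiftingProperty_iff j q).1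
      (h _ (freeMaps_map hc hj))
  · rintro h _ _ _ ⟨⟨⟨c, hc⟩, ⟨j, hj⟩⟩⟩
    exact ((evaluationAdjunctionRight M c).hasLiftingProperty_iff j.hom q).2 (h c hc _ hj)

instance [MorphismProperty.IsSmall.{v} J] : MorphismProperty.IsSmall.{v} (freeMaps J N) := by
  unfold freeMaps
  infer_instance

lemma IsSaturatedClass.freeMaps_le (hC : IsSaturatedClass C) (hJC : J ≤ C) :
    freeMaps J N ≤ C.functorCategory D := by
  have := hC.isStableUnderCoproducts
  rintro _ _ _ ⟨⟨⟨c, _⟩, ⟨j, hj⟩⟩⟩ d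
  have : C (Limits.Sigma.map fun _ : c ⟶ d ↦ j.hom) :=
    C.colimMap _ fun _ ↦ hJC _ hj
  exact this

lemma hasSmallObjectArgument_freeMaps [MorphismProperty.IsSmall.{v} J]
    (hC : IsSaturatedClass C) (hJC : J ≤ C)
    (hJ : ∀ ⦃A B : M⦄ (j : A ⟶ B), J j → IsSequentiallyFiniteRelativeTo C A) (N : Set D) :
    MorphismProperty.HasSmallObjectArgument.{v} (freeMaps J N) := by
  refine hasSmallObjectArgument_of_isSequentiallyFiniteRelativeTo hC.functorCategory
    (hC.freeMaps_le hJC) ?_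
  rintro _ _ _ ⟨⟨⟨c, _⟩, ⟨j, hj⟩⟩⟩
  exact isSequentiallyFiniteRelativeTo_evaluationLeftAdjoint_obj (hJ j.hom hj) c

variable {X Z : D ⥤ M} {φ : X ⟶ Z}

lemma app_mem_llp_rlp [HasLimits M] (hφ : (freeMaps J N).rlp.llp φ) (d : D) :
    J.rlp.llp (φ.app d) := by
  intro E B r hr
  refine ((evaluationAdjunctionLeft M d).hasLiftingProperty_iff φ r).2 (hφ _ ?_)
  rw [freeMaps_rlp_iff]
  intro c _ A B j hj
  have := hr j hj
  exact inferInstanceAs (HasLiftingProperty j (Limits.Pi.map fun _ : c ⟶ d ↦ r))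

lemma colimMap_mem_llp_rlp (hφ : (freeMaps J N).rlp.llp φ) : J.rlp.llp (colimMap φ) := by
  intro E B r hr
  refine (colimConstAdj.hasLiftingProperty_iff φ r).2 (hφ _ ?_)
  rw [freeMaps_rlp_iff]
  intro c _
  exact hr

end FreeMaps

section Corner

section

variable {C₁ C₂ C₃ : Type*} [Category* C₁] [Category* C₂] [Category* C₃]
  (F : C₁ ⥤ C₂ ⥤ C₃)

lemma exists_parametrizedAdjunction [∀ X, (F.obj X).IsLeftAdjoint] :
    ∃ G : C₁ᵒᵖ ⥤ C₃ ⥤ C₂, Nonempty (F ⊣₂ G) := by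
  let adj (X : C₁) := Adjunction.ofIsLeftAdjoint (F.obj X)
  let G : C₁ᵒᵖ ⥤ C₃ ⥤ C₂ :=
    { obj X := (F.obj X.unop).rightAdjoint
      map f := conjugateEquiv (adj _) (adj _) (F.map f.unop)
      map_id X := by simp
      map_comp f g := by simp }
  exact ⟨G, ⟨{ adj := adj
               unit_whiskerRight_map f := by
                ext X
                exact (unit_conjugateEquiv (adj _) (adj _) (F.map f) X).symm }⟩⟩

variable {F}

lemma pushoutObjObj_ι_mem_llp_rlp [HasPullbacks C₂] [HasPushouts C₃]
    [∀ X, (F.obj X).IsLeftAdjoint] {T : MorphismProperty C₂} {J : MorphismProperty C₃}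
    {X Y : C₁} {e : X ⟶ Y}
    (hT : ∀ ⦃A B : C₂⦄ (t : A ⟶ B), T t →
      J.rlp.llp (Functor.PushoutObjObj.ofHasPushout F e t).ι)
    {A B : C₂} {φ : A ⟶ B} (hφ : T.rlp.llp φ) :
    J.rlp.llp (Functor.PushoutObjObj.ofHasPushout F e φ).ι := by
  obtain ⟨G, ⟨adj⟩⟩ := exists_parametrizedAdjunction F
  intro E B r hr
  rw [adj.hasLiftingProperty_iff _ (Functor.PullbackObjObj.ofHasPullback G e r)]
  refine hφ _ fun _ _ t ht ↦ ?_
  rw [← adj.hasLiftingProperty_iff (Functor.PushoutObjObj.ofHasPushout F e t)]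
  exact hT t ht r hr

namespace PushoutObjObj

variable {X₁ Y₁ : C₁} {f₁ : X₁ ⟶ Y₁} {X₂ Y₂ : C₂} {f₂ : X₂ ⟶ Y₂}
  (sq : F.PushoutObjObj f₁ f₂)

lemma isIso_ι [IsIso ((F.map f₁).app X₂)] [IsIso ((F.map f₁).app Y₂)] : IsIso sq.ι :=
  have := sq.isPushout.isIso_inr_of_isIso
  IsIso.of_isIso_fac_left sq.inr_ι

lemma ι_mem_of_isIso {W : MorphismProperty C₃} [W.RespectsIso] [IsIso ((F.obj X₁).map f₂)]
    (h : W ((F.obj Y₁).map f₂)) : W sq.ι := by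
  have := sq.isPushout.isIso_inl_of_isIso
  rwa [← sq.inl_ι, W.cancel_left_of_respectsIso] at h

end PushoutObjObj

end

variable {M : Type u} [Category.{v} M] [HasColimits M] {D : Type v} [Preorder D]

lemma isIso_evaluationLeftAdjoint_obj_map {c d d' : D} (hcd : c ≤ d) (e : d ⟶ d') (A : M) :
    IsIso (((evaluationLeftAdjoint M c).obj A).map e) := by
  let g : c ⟶ d := homOfLE hcd
  let ι {d : D} (g : c ⟶ d) : A ⟶ ((evaluationLeftAdjoint M c).obj A).obj d :=
    Sigma.ι (fun _ : c ⟶ d ↦ A) g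
  have isIso_ι {d : D} (g : c ⟶ d) : IsIso (ι g) :=
    isIso_ι_of_isTerminal (IsTerminal.ofUniqueHom (fun _ ↦ eqToHom (Subsingleton.elim _ _))
      fun _ _ ↦ Subsingleton.elim _ _) _
  have hg : ι g ≫ ((evaluationLeftAdjoint M c).obj A).map e = ι (g ≫ e) := Sigma.ι_desc _ _
  exact IsIso.of_isIso_fac_left hg

/-- At an index `d` that is not above `c`, the free diagram on an object at `c` is initial. -/
noncomputable def isInitialEvaluationLeftAdjointObj {c d : D} (hcd : ¬ c ≤ d) (A : M) :
    IsInitial (((evaluationLeftAdjoint M c).obj A).obj d) :=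
  have : IsEmpty (c ⟶ d) := ⟨fun f ↦ hcd (leOfHom f)⟩
  isColimitEquivIsInitialOfIsEmpty _ _ (colimit.isColimit (Discrete.functor fun _ : c ⟶ d ↦ A))

lemma isIso_evaluationLeftAdjoint_map_app {c d : D} (hcd : ¬ c ≤ d) {A B : M} (j : A ⟶ B) :
    IsIso (((evaluationLeftAdjoint M c).map j).app d) :=
  isIso_of_isInitial (isInitialEvaluationLeftAdjointObj hcd A)
    (isInitialEvaluationLeftAdjointObj hcd B) _

variable [HasLimits M] {J C : MorphismProperty M} {N : Set D}

lemma pushoutObjObj_evaluation_ι_mem_llp_rlp {d d' : D} (e : d ⟶ d') {X Z : D ⥤ M} {φ : X ⟶ Z}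
    (hφ : (freeMaps J N).rlp.llp φ) :
    J.rlp.llp (Functor.PushoutObjObj.ofHasPushout (evaluation D M) e φ).ι := by
  refine pushoutObjObj_ι_mem_llp_rlp ?_ hφ
  rintro _ _ _ ⟨⟨⟨c, hc⟩, ⟨j, hj⟩⟩⟩
  by_cases hcd : c ≤ d
  · have (A : M) : IsIso (((evaluation D M).map e).app ((evaluationLeftAdjoint M c).obj A)) :=
      isIso_evaluationLeftAdjoint_obj_map hcd e A
    have := PushoutObjObj.isIso_ι (Functor.PushoutObjObj.ofHasPushout (evaluation D M) e
      ((evaluationLeftAdjoint M c).map j.hom))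
    exact MorphismProperty.of_isIso _ _
  · have : IsIso (((evaluation D M).obj d).map ((evaluationLeftAdjoint M c).map j.hom)) :=
      isIso_evaluationLeftAdjoint_map_app hcd j.hom
    exact PushoutObjObj.ι_mem_of_isIso _
      (app_mem_llp_rlp (MorphismProperty.le_llp_rlp _ _ (freeMaps_map hc hj)) d')

lemma map_mem_of_llp_rlp (hC : IsSaturatedClass C) (hJC : J.rlp.llp ≤ C) {X Z : D ⥤ M}
    {φ : X ⟶ Z} (hφ : (freeMaps J N).rlp.llp φ) {d d' : D} (e : d ⟶ d') (he : C (X.map e)) :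
    C (Z.map e) := by
  have := hC.pushouts
  have := hC.transfiniteCompositions
  let sq := Functor.PushoutObjObj.ofHasPushout (evaluation D M) e φ
  have hZ : sq.inr ≫ sq.ι = Z.map e := sq.inr_ι
  rw [← hZ]
  exact C.comp_mem _ _ (C.of_isPushout sq.isPushout.flip he)
    (hJC _ (pushoutObjObj_evaluation_ι_mem_llp_rlp e hφ))

end Corner

section Continuity

lemma isIso_of_hasLiftingProperty_self {C : Type*} [Category* C] {A B : C} (f : A ⟶ B)
    [HasLiftingProperty f f] : IsIso f :=
  have sq : CommSq (𝟙 A) f f (𝟙 B) := ⟨by simp⟩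
  ⟨sq.lift, sq.fac_left, sq.fac_right⟩

-- `κ_Z` is the cobase change of `κ_X` along `U φ` followed by the corner map of `κ` and `φ`, and
-- the corner map is an isomorphism because it has the left lifting property against all maps.
lemma isIso_app_of_llp_rlp {C₂ C₃ : Type*} [Category* C₂] [Category* C₃] [HasPullbacks C₂]
    [HasPushouts C₃] {U V : C₂ ⥤ C₃} [U.IsLeftAdjoint] [V.IsLeftAdjoint] (κ : U ⟶ V)
    {T : MorphismProperty C₂}
    (hT : ∀ ⦃A B : C₂⦄ (t : A ⟶ B), T t → IsIso (κ.app A) ∧ IsIso (κ.app B))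
    {X Z : C₂} {φ : X ⟶ Z} (hφ : T.rlp.llp φ) [IsIso (κ.app X)] : IsIso (κ.app Z) := by
  let F : Fin 2 ⥤ C₂ ⥤ C₃ := ComposableArrows.mk₁ κ
  let e : (0 : Fin 2) ⟶ 1 := homOfLE (Fin.zero_le 1)
  have (i : Fin 2) : (F.obj i).IsLeftAdjoint := by
    fin_cases i <;> assumption
  have hι : (⊥ : MorphismProperty C₃).rlp.llp (Functor.PushoutObjObj.ofHasPushout F e φ).ι := by
    refine pushoutObjObj_ι_mem_llp_rlp (fun A B t ht ↦ ?_) hφ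
    have : IsIso ((F.map e).app A) := (hT t ht).1
    have : IsIso ((F.map e).app B) := (hT t ht).2
    have := PushoutObjObj.isIso_ι (Functor.PushoutObjObj.ofHasPushout F e t)
    exact MorphismProperty.of_isIso _ _
  let sq := Functor.PushoutObjObj.ofHasPushout F e φ
  have : HasLiftingProperty sq.ι sq.ι := hι sq.ι fun _ _ _ h ↦ h.elim
  have hι : IsIso sq.ι := isIso_of_hasLiftingProperty_self sq.ι
  have : IsIso ((F.map e).app X) := ‹IsIso (κ.app X)›
  have hinr : IsIso sq.inr := sq.isPushout.isIso_inr_of_isIso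
  have hZ : sq.inr ≫ sq.ι = κ.app Z := sq.inr_ι
  exact hZ ▸ IsIso.comp_isIso' hinr hι

variable {M : Type u} [Category.{v} M] [HasColimits M] {L : Type v} [LinearOrder L]

lemma isWellOrderContinuous_evaluationLeftAdjoint_obj {c : L} (hc : ¬ Order.IsSuccLimit c)
    (A : M) : ((evaluationLeftAdjoint M c).obj A).IsWellOrderContinuous := by
  refine isWellOrderContinuous_of_isEventuallyConstantFrom fun m hm ↦ ?_
  rcases lt_or_ge c m with hcm | hmc
  · exact ⟨c, hcm, fun k l φ hk _ ↦ isIso_evaluationLeftAdjoint_obj_map hk φ A⟩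
  · have hmc : m < c := hmc.lt_of_ne fun h ↦ hc (h ▸ hm)
    obtain ⟨j, hj⟩ := not_isMin_iff.1 hm.1
    exact ⟨j, hj, fun k l φ _ hl ↦ isIso_of_isInitial
      (isInitialEvaluationLeftAdjointObj ((leOfHom φ).trans_lt (hl.trans_lt hmc)).not_ge A)
      (isInitialEvaluationLeftAdjointObj (hl.trans_lt hmc).not_ge A) _⟩

variable (M) in
/-- The canonical map from the colimit of a diagram over the elements below `m` to its value
at `m`. A diagram is continuous at `m` if its component there is an isomorphism. -/
noncomputable def colimIioToEvaluation (m : L) :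
    (Functor.whiskeringLeft _ _ M).obj (Set.principalSegIio m).monotone.functor ⋙ colim ⟶
      (evaluation L M).obj m where
  app F := colimit.desc _ ((Set.principalSegIio m).cocone F)
  naturality F G f := by
    refine colimit.hom_ext fun j ↦ (ι_colimMap_assoc _ _ _).trans ?_
    have hF := colimit.ι_desc ((Set.principalSegIio m).cocone F) j
    have hG := colimit.ι_desc ((Set.principalSegIio m).cocone G) j
    exact (whisker_eq _ hG).trans <| (f.naturality _).symm.trans ((reassoc_of% hF) (f.app m)).symm

lemma isIso_colimIioToEvaluation_iff (m : L) (F : L ⥤ M) :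
    IsIso ((colimIioToEvaluation M m).app F) ↔
      Nonempty (IsColimit ((Set.principalSegIio m).cocone F)) :=
  ((colimit.isColimit _).nonempty_isColimit_iff_isIso_desc).symm

lemma isWellOrderContinuous_of_llp_rlp [HasLimits M] {J : MorphismProperty M} {N : Set L}
    (hN : ∀ c ∈ N, ¬ Order.IsSuccLimit c) {X Z : L ⥤ M} {φ : X ⟶ Z}
    (hφ : (freeMaps J N).rlp.llp φ) [X.IsWellOrderContinuous] : Z.IsWellOrderContinuous := by
  refine ⟨fun m hm ↦ (isIso_colimIioToEvaluation_iff m Z).1 ?_⟩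
  have isIso_of_isWellOrderContinuous (F : L ⥤ M) [F.IsWellOrderContinuous] :
      IsIso ((colimIioToEvaluation M m).app F) :=
    (isIso_colimIioToEvaluation_iff m F).2 ⟨F.isColimitOfIsWellOrderContinuous m hm⟩
  have := isIso_of_isWellOrderContinuous X
  let r := (Set.principalSegIio m).monotone.functor
  have : ((Functor.whiskeringLeft _ _ M).obj r).IsLeftAdjoint := (r.ranAdjunction M).isLeftAdjoint
  have : ((evaluation L M).obj m).IsLeftAdjoint := (evaluationAdjunctionLeft M m).isLeftAdjoint
  refine isIso_app_of_llp_rlp (colimIioToEvaluation M m) ?_ hφ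
  rintro _ _ _ ⟨⟨⟨c, hc⟩, ⟨j, hj⟩⟩⟩
  have := isWellOrderContinuous_evaluationLeftAdjoint_obj (M := M) (hN c hc)
  exact ⟨isIso_of_isWellOrderContinuous _, isIso_of_isWellOrderContinuous _⟩

end Continuity

section Colimits

variable {M : Type u} [Category.{v} M] [HasColimits M] {D : Type v} [SmallCategory D]

lemma exists_commSq_app_of_commSq_colimMap [IsFiltered D] {Z Y : D ⥤ M} {q : Z ⟶ Y} {A B : M}
    {i : A ⟶ B} [PreservesColimit Z (coyoneda.obj (op A))]
    [PreservesColimit Y (coyoneda.obj (op A))] [PreservesColimit Y (coyoneda.obj (op B))]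
    {f : A ⟶ colimit Z} {g : B ⟶ colimit Y} (sq : CommSq f i (colimMap q) g) :
    ∃ (d : D) (f' : A ⟶ Z.obj d) (g' : B ⟶ Y.obj d),
      f' ≫ colimit.ι Z d = f ∧ g' ≫ colimit.ι Y d = g ∧ CommSq f' i (q.app d) g' := by
  obtain ⟨d₁, f', rfl⟩ := exists_hom_of_preservesColimit_coyoneda (colimit.isColimit Z) f
  obtain ⟨d₂, g', rfl⟩ := exists_hom_of_preservesColimit_coyoneda (colimit.isColimit Y) g
  have hcolim : (f' ≫ q.app d₁) ≫ colimit.ι Y d₁ = (i ≫ g') ≫ colimit.ι Y d₂ := by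
    simpa using sq.w
  obtain ⟨d, u, v, hd⟩ :=
    exists_eq_of_preservesColimit_coyoneda (colimit.isColimit Y) _ _ hcolim
  exact ⟨d, f' ≫ Z.map u, g' ≫ Y.map v, by simp, by simp, ⟨by simpa using hd⟩⟩

lemma hasLiftingProperty_colimMap [IsFiltered D] {N : Set D}
    (hN : ∀ d : D, ∃ c ∈ N, Nonempty (d ⟶ c)) {Z Y : D ⥤ M} (q : Z ⟶ Y)
    {A B : M} (i : A ⟶ B) [PreservesColimit Z (coyoneda.obj (op A))]
    [PreservesColimit Y (coyoneda.obj (op A))] [PreservesColimit Y (coyoneda.obj (op B))]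
    (h : ∀ c ∈ N, HasLiftingProperty i (q.app c)) : HasLiftingProperty i (colimMap q) := by
  refine ⟨fun sq ↦ ?_⟩
  obtain ⟨d, f', g', rfl, rfl, sq'⟩ := exists_commSq_app_of_commSq_colimMap sq
  obtain ⟨c, hc, ⟨u⟩⟩ := hN d
  have sq'' : CommSq (f' ≫ Z.map u) i (q.app c) (g' ≫ Y.map u) :=
    ⟨by simp [sq'.w_assoc]⟩
  have := h c hc
  exact ⟨⟨sq''.lift ≫ colimit.ι Z c, by simp, by simp⟩⟩

lemma colimMap_mem_of_final {W : MorphismProperty M} [W.RespectsIso] {D' : Type v}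
    [SmallCategory D'] (e : D' ⥤ D) [e.Final] {F G : D ⥤ M} (p : F ⟶ G)
    (hp : W (colimMap (Functor.whiskerLeft e p))) : W (colimMap p) := by
  refine (W.arrow_mk_iso_iff (Arrow.isoMk (Functor.Final.colimitIso e F)
    (Functor.Final.colimitIso e G) ?_)).1 hp
  dsimp
  ext
  simp

end Colimits

section Closure

variable {M : Type u} [Category.{v} M] [HasLimits M] [HasColimits M]
  {W I J C : MorphismProperty M} [W.HasTwoOutOfThreeProperty]

lemma colimMap_mem_of_preservesColimit (hJW : J.rlp.llp ≤ W) (hI : J.rlp ⊓ W = I.rlp)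
    {D : Type v} [SmallCategory D] [IsFiltered D] (N : Set D)
    [MorphismProperty.HasSmallObjectArgument.{v} (freeMaps J N)]
    (hN : ∀ d : D, ∃ c ∈ N, Nonempty (d ⟶ c)) {X Y : D ⥤ M} (p : X ⟶ Y)
    (hp : ∀ d, W (p.app d))
    (hX : ∀ ⦃Z : D ⥤ M⦄ (φ : X ⟶ Z), (freeMaps J N).rlp.llp φ →
      ∀ ⦃A B : M⦄ (i : A ⟶ B), I i → PreservesColimit Z (coyoneda.obj (op A)))
    (hY : ∀ ⦃A B : M⦄ (i : A ⟶ B), I i →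
      PreservesColimit Y (coyoneda.obj (op A)) ∧ PreservesColimit Y (coyoneda.obj (op B))) :
    W (colimMap p) := by
  obtain ⟨Z, φ, q, rfl, hφ, hq⟩ :=
    MorphismProperty.factorizationData (freeMaps J N).rlp.llp (freeMaps J N).rlp p
  rw [freeMaps_rlp_iff] at hq
  have hqI (c : D) (hc : c ∈ N) : I.rlp (q.app c) := by
    rw [← hI]
    exact ⟨hq c hc, W.of_precomp (φ.app c) _ (hJW _ (app_mem_llp_rlp hφ c)) (hp c)⟩
  have hqW : W (colimMap q) := by
    refine (hI.ge.trans inf_le_right) _ fun A B i hi ↦ ?_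
    have := hX φ hφ i hi
    obtain ⟨_, _⟩ := hY i hi
    exact hasLiftingProperty_colimMap hN q i fun c hc ↦ hqI c hc i hi
  have hcolim : colimMap (φ ≫ q) = colimMap φ ≫ colimMap q := by
    ext
    simp
  rw [hcolim]
  exact W.comp_mem _ _ (hJW _ (colimMap_mem_llp_rlp hφ)) hqW

variable [MorphismProperty.IsSmall.{v} J]

theorem isClosedUnderFilteredColimitsAlong [W.RespectsIso] (hC : IsSaturatedClass C) (hJC : J ≤ C)
    (hJW : J.rlp.llp ≤ W) (hI : J.rlp ⊓ W = I.rlp)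
    (hJ : ∀ ⦃A B : M⦄ (j : A ⟶ B), J j → IsSequentiallyFiniteRelativeTo C A)
    (hIfin : ∀ ⦃A B : M⦄ (i : A ⟶ B), I i → IsFiniteRelativeTo C A ∧ IsFiniteRelativeTo C B) :
    IsClosedUnderFilteredColimitsAlong W C := by
  intro D _ _ F G hF hG p hp
  obtain ⟨D', _, _, _, e, _⟩ := IsFiltered.exists_directed D
  have := hasSmallObjectArgument_of_isSequentiallyFiniteRelativeTo hC hJC hJ
  have := hasSmallObjectArgument_freeMaps hC hJC hJ (Set.univ : Set D')
  refine colimMap_mem_of_final e p (colimMap_mem_of_preservesColimit hJW hI Set.univ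
    (fun d ↦ ⟨d, trivial, ⟨𝟙 d⟩⟩) _ (fun d ↦ hp _) (fun Z φ hφ A B i hi ↦ ?_) fun A B i hi ↦ ?_)
  · exact (hIfin i hi).1 D' Z fun d d' g ↦
      map_mem_of_llp_rlp hC (hC.llp_rlp_le hJC) hφ g (hF (e.map g))
  · exact (hIfin i hi).imp (fun h ↦ h D' _ fun d d' g ↦ hG _) (fun h ↦ h D' _ fun d d' g ↦ hG _)

theorem isClosedUnderSequentialColimitsAlong (hC : IsSaturatedClass C) (hJC : J ≤ C)
    (hJW : J.rlp.llp ≤ W) (hI : J.rlp ⊓ W = I.rlp)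
    (hJ : ∀ ⦃A B : M⦄ (j : A ⟶ B), J j → IsSequentiallyFiniteRelativeTo C A)
    (hIfin : ∀ ⦃A B : M⦄ (i : A ⟶ B), I i →
      IsSequentiallyFiniteRelativeTo C A ∧ IsSequentiallyFiniteRelativeTo C B) :
    IsClosedUnderSequentialColimitsAlong W C := by
  intro L _ _ _ _ _ F G hF hG p hp
  have := hasSmallObjectArgument_of_isSequentiallyFiniteRelativeTo hC hJC hJ
  have := hasSmallObjectArgument_freeMaps hC hJC hJ (D := L) {j | ¬ Order.IsSuccLimit j}
  refine colimMap_mem_of_preservesColimit hJW hI {j | ¬ Order.IsSuccLimit j}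
    (fun j ↦ ⟨Order.succ j, Order.not_isSuccLimit_succ j, ⟨homOfLE (Order.le_succ j)⟩⟩) p hp
    (fun Z φ hφ A B i hi ↦ (hIfin i hi).1.preservesColimit ⟨?_, fun j ↦ ?_⟩)
    fun A B i hi ↦ (hIfin i hi).imp (·.preservesColimit hG) (·.preservesColimit hG)
  · have := hF.continuous
    exact isWellOrderContinuous_of_llp_rlp (fun _ h ↦ h) hφ
  · exact map_mem_of_llp_rlp hC (hC.llp_rlp_le hJC) hφ _ (hF.map_succ j)

end Closure

section LocallyPresentable

lemma isSmallRelativeTo_of_isLocallyPresentable {M : Type u} [Category.{v} M]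
    [IsLocallyPresentable.{v} M] (C : MorphismProperty M) (X : M) : IsSmallRelativeTo C X := by
  have hX : IsPresentable.{v} X := inferInstance
  obtain ⟨κ, _, _⟩ := hX.exists_cardinal
  refine ⟨κ, fun L _ _ _ _ _ hL F _ ↦ ?_⟩
  have : IsCardinalFiltered L κ := isCardinalFiltered_preorder _ _ fun ι s hι ↦ by
    obtain ⟨b, hb⟩ := hL (Set.range s) (Cardinal.mk_range_le.trans hι.le)
    exact ⟨b, fun k ↦ hb ⟨k, rfl⟩⟩
  have := preservesColimitsOfShape_of_isCardinalPresentable X κ L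
  infer_instance

end LocallyPresentable

section Tensor

variable {M : Type u} [Category.{v} M] [SimplicialCategory M]

namespace SimplicialTensor

variable {A : M} {S : SSet.{v}} (t : SimplicialTensor A S)

/-- The isomorphism `Map(A ⊗ S, Y) ⟶ Map(S, Map(A, Y))` of the universal property of a tensor. -/
noncomputable abbrev sHomComparison (Y : M) :=
  MonoidalClosed.curry (t.unit ▷ SimplicialCategory.sHom t.obj Y ≫
    SimplicialCategory.sHomComp A t.obj Y)

lemma eHomEquiv_comp_sHomComparison {Y : M} (f : t.obj ⟶ Y) :
    eHomEquiv SSet.{v} f ≫ t.sHomComparison Y =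
      MonoidalClosed.curry' (t.unit ≫ sHomPost A f) := by
  rw [sHomComparison, ← MonoidalClosed.curry_natural_left, MonoidalClosed.curry']
  congr 1

/-- The bijection between morphisms `A ⊗ S ⟶ Y` and morphisms `S ⟶ Map(A, Y)`, on `0`-simplices
of the universal property of a tensor. -/
noncomputable def homEquiv (Y : M) : (t.obj ⟶ Y) ≃ (S ⟶ SimplicialCategory.sHom A Y) where
  toFun f := t.unit ≫ sHomPost A f
  invFun g := t.desc g
  left_inv f := by
    dsimp only [desc]
    rw [← eHomEquiv_comp_sHomComparison, Category.assoc, IsIso.hom_inv_id, Category.comp_id,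
      Equiv.symm_apply_apply]
  right_inv g := by
    refine MonoidalClosed.curry'_injective
      ((t.eHomEquiv_comp_sHomComparison (t.desc g)).symm.trans ?_)
    rw [desc, Equiv.apply_symm_apply, Category.assoc, IsIso.inv_hom_id, Category.comp_id]

/-- The natural form of `homEquiv`: `A ⊗ S` corepresents `Y ↦ Hom(S, Map(A, Y))`. -/
noncomputable def coyonedaIso :
    coyoneda.obj (op t.obj) ≅ eCoyoneda SSet.{v} A ⋙ coyoneda.obj (op S) :=
  NatIso.ofComponents (fun Y ↦ (t.homEquiv Y).toIso) (by
    intro Y Y' f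
    ext g
    change t.unit ≫ sHomPost A (g ≫ f) = (t.unit ≫ sHomPost A g) ≫ sHomPost A f
    rw [sHomPost, eHomWhiskerLeft_comp, Category.assoc])

end SimplicialTensor

variable {D : Type v} [SmallCategory D]

lemma preservesColimit_eCoyoneda (A : M) (F : D ⥤ M) (t : ∀ n : ℕ, SimplicialTensor A Δ[n])
    (ht : ∀ n, PreservesColimit F (coyoneda.obj (op (t n).obj))) :
    PreservesColimit F (eCoyoneda SSet.{v} A) := by
  refine preservesColimit_of_evaluation (K := SimplexCategoryᵒᵖ) _ F fun n ↦ ?_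
  have := ht n.unop.len
  let e : coyoneda.obj (op (Δ[n.unop.len] : SSet.{v})) ≅
      (evaluation SimplexCategoryᵒᵖ (Type v)).obj n :=
    NatIso.ofComponents (fun X ↦ SSet.yonedaEquiv.toIso) fun _ ↦ rfl
  exact preservesColimit_of_natIso F
    ((t n.unop.len).coyonedaIso ≪≫ Functor.isoWhiskerLeft (eCoyoneda SSet.{v} A) e)

variable [ModelCategory M] [SimplicialModelCategory M] {A : M} {C : MorphismProperty M}

lemma preservesColimit_coyoneda_sTensor [IsFiltered D] {F : D ⥤ M}
    (hF : ∀ n : ℕ, PreservesColimit F (coyoneda.obj (op (sTensor A Δ[n]))))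
    (S : SSet.{v}) [S.Finite] : PreservesColimit F (coyoneda.obj (op (sTensor A S))) := by
  have := preservesColimit_eCoyoneda A F (fun n ↦ SimplicialModelCategory.tensor A Δ[n]) hF
  exact preservesColimit_of_natIso F (SimplicialModelCategory.tensor A S).coyonedaIso.symm

lemma IsFiniteRelativeTo.sTensor (h : ∀ n : ℕ, IsFiniteRelativeTo C (sTensor A Δ[n]))
    (S : SSet.{v}) [S.Finite] : IsFiniteRelativeTo C (RightBousfield.sTensor A S) :=
  fun D _ _ F hF ↦ preservesColimit_coyoneda_sTensor (fun n ↦ h n D F hF) S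

lemma IsSequentiallyFiniteRelativeTo.sTensor
    (h : ∀ n : ℕ, IsSequentiallyFiniteRelativeTo C (sTensor A Δ[n]))
    (S : SSet.{v}) [S.Finite] : IsSequentiallyFiniteRelativeTo C (RightBousfield.sTensor A S) :=
  ⟨0, fun _ _ _ _ _ _ _ _ hF ↦
    preservesColimit_coyoneda_sTensor (fun n ↦ (h n).preservesColimit hF) S⟩

lemma domain_and_codomain_of_lambdaSet_sup {K : ObjectProperty M} {J : MorphismProperty M}
    {P : ObjectProperty M} (hK : ∀ (A : M) (S : SSet.{v}) [S.Finite], K A → P (sTensor A S))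
    (hJ : ∀ ⦃A B : M⦄ (j : A ⟶ B), J j → P A ∧ P B) ⦃A B : M⦄ (i : A ⟶ B)
    (hi : (LambdaSet K ⊔ J) i) : P A ∧ P B := by
  rcases hi with ⟨⟨⟨A, hA⟩, n⟩⟩ | hi
  · exact ⟨hK A _ hA, hK A _ hA⟩
  · exact hJ i hi

end Tensor

section ModelStructure

variable {M : Type u} [Category.{v} M] {W Cof Fib I J : MorphismProperty M}

namespace IsModelStructure

lemma hasTwoOutOfThreeProperty (h : IsModelStructure W Cof Fib) : W.HasTwoOutOfThreeProperty := by
  obtain ⟨h, rfl, -, -⟩ := h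
  exact h.cm2

lemma isStableUnderRetracts (h : IsModelStructure W Cof Fib) : W.IsStableUnderRetracts := by
  obtain ⟨h, rfl, -, -⟩ := h
  exact h.cm3a

lemma llp_le (h : IsModelStructure W Cof Fib) : Fib.llp ≤ W := by
  obtain ⟨h, rfl, -, rfl⟩ := h
  exact (fibrations_llp M).trans_le inf_le_right

end IsModelStructure

end ModelStructure

end RightBousfield

theorem mainTheorem5 {M : Type u} [Category.{v} M] [HasLimits M] [HasColimits M]
    [ModelCategory M] [SimplicialCategory M] [SimplicialModelCategory M]
    (I J : MorphismProperty M)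
    (hM : IsCofibrantlyGenerated (weakEquivalences M) (cofibrations M) (fibrations M) I J)
    (C : MorphismProperty M) (hC : IsSaturatedClass C) (hJC : J ≤ C)
    (K : ObjectProperty M) [ObjectProperty.Small.{v} K] (hK : ∀ A : M, K A → IsCofibrant A)
    (J' : MorphismProperty M)
    (hR : IsCofibrantlyGenerated (colocalEquivalences K) (colocalCofibrations K) (fibrations M)
      (LambdaSet K ⊔ J) J') :
    ((∀ (A : M) (n : ℕ), K A → IsFiniteRelativeTo C (sTensor A Δ[n])) →
      (∀ ⦃A B : M⦄ (j : A ⟶ B), J j → IsFiniteRelativeTo C A ∧ IsFiniteRelativeTo C B) →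
      IsClosedUnderFilteredColimitsAlong (colocalEquivalences K) C ∧
      ((∀ X : M, IsSmallRelativeTo C X) →
        IsCompactlyGeneratedModel (colocalEquivalences K) (colocalCofibrations K) (fibrations M) C)) ∧
    ((∀ (A : M) (n : ℕ), K A → IsSequentiallyFiniteRelativeTo C (sTensor A Δ[n])) →
      (∀ ⦃A B : M⦄ (j : A ⟶ B), J j →
        IsSequentiallyFiniteRelativeTo C A ∧ IsSequentiallyFiniteRelativeTo C B) →
      IsClosedUnderSequentialColimitsAlong (colocalEquivalences K) C) ∧
    (IsLocallyPresentable.{v} M → ∀ X : M, IsSmallRelativeTo C X) := by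
  have := hM.isSmall_J
  have := hR.isModelStructure.hasTwoOutOfThreeProperty
  have := hR.isModelStructure.isStableUnderRetracts
  have hJW : J.rlp.llp ≤ colocalEquivalences K := hM.fib_eq ▸ hR.isModelStructure.llp_le
  have hI : J.rlp ⊓ colocalEquivalences K = (LambdaSet K ⊔ J).rlp := hM.fib_eq ▸ hR.trivialFib_eq
  refine ⟨fun hKfin hJfin ↦ ?_, fun hKfin hJfin ↦ ?_,
    fun _ ↦ isSmallRelativeTo_of_isLocallyPresentable C⟩
  · have hclosed : IsClosedUnderFilteredColimitsAlong (colocalEquivalences K) C :=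
      isClosedUnderFilteredColimitsAlong hC hJC hJW hI
        (fun _ _ j hj ↦ (hJfin j hj).1.isSequentiallyFiniteRelativeTo hC)
        (domain_and_codomain_of_lambdaSet_sup (P := IsFiniteRelativeTo C)
          (fun A S _ hA ↦ .sTensor (hKfin A · hA) S) hJfin)
    exact ⟨hclosed, fun hsmall ↦ ⟨⟨_, _, hR⟩, hclosed, hsmall⟩⟩
  · exact isClosedUnderSequentialColimitsAlong hC hJC hJW hI (fun _ _ j hj ↦ (hJfin j hj).1)
      (domain_and_codomain_of_lambdaSet_sup (P := IsSequentiallyFiniteRelativeTo C)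
        (fun A S _ hA ↦ .sTensor (hKfin A · hA) S) hJfin)
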